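/- A continuum is a nonempty compact connected metric space, and a subcontinuum of $X$ is a nonempty compact connected subset of $X$. A continuum $X$ is tree-like if for every $\varepsilon>0$ there are a tree $T$ (a finite connected acyclic graph, regarded as a topological space) and a continuous map $f:X\to T$ such that $\operatorname{diam}(f^{-1}\{t\})<\varepsilon$ for each $t\in T$. For $x\in X$ let $M_x$ be the union of all nowhere dense subcontinua of $X$ that contain $x$; the meager composants of $X$ are the sets $M_x$, $x\in X$. Theorem. If $X$ is a tree-like continuum, then the set $\{M_x : x\in X\}$ of meager composants of $X$ has cardinality exactly $1$ or exactly $2^{\aleph_0}$. -/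

import Mathlib

open Set

/-- The union of all nowhere dense subcontinua (compact connected subsets) of `X` containing `x`. -/
def meagerComposant {X : Type*} [TopologicalSpace X] (x : X) : Set X :=
  ⋃₀ {L : Set X | IsCompact L ∧ IsConnected L ∧ IsNowhereDense L ∧ x ∈ L}

/-- The set of all meager composants of `X`. -/
def meagerComposants (X : Type*) [TopologicalSpace X] : Set (Set X) :=
  {M : Set X | ∃ x : X, M = meagerComposant x}

/-- The geometric realization of a graph `G` in `V → ℝ`: its vertices are the standard unit vectors,
and the unit vectors of any two adjacent vertices are joined by a straight line segment. -/
def graphRealization {V : Type*} [DecidableEq V] (G : SimpleGraph V) : Set (V → ℝ) :=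
  {p | (∃ v : V, p = Pi.single v 1) ∨
    ∃ v w : V, G.Adj v w ∧ p ∈ segment ℝ (Pi.single v (1 : ℝ)) (Pi.single w (1 : ℝ))}

/-- `X` is tree-like: for every `ε > 0` there is a continuous map from `X` to (the realization of)
a finite tree all of whose point inverses have diameter less than `ε`. -/
def IsTreeLike (X : Type*) [MetricSpace X] : Prop :=
  ∀ ε : ℝ, 0 < ε → ∃ (n : ℕ) (T : SimpleGraph (Fin n)) (f : X → graphRealization T),
    T.IsTree ∧ Continuous f ∧ ∀ t : graphRealization T, Metric.diam (f ⁻¹' {t}) < ε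

/-! Connected subsets of a tree have connected intersections, and maps with small fibres carry this
back to closed sets in `X`: a tree-like continuum is hereditarily unicoherent
(`IsTreeLike.isPreconnected_inter`). Hence any `x`, `y` lie in a least subcontinuum `continuumHull x
y`. For nondegenerate `X` they have the same meager composant exactly when this hull has empty
interior.

Suppose two meager composants differ, and let `U` be the nonempty interior of the corresponding
hull. The heart of the proof is that every meager composant is meagre in `U`
(`HereditarilyUnicoherent.isMeagre_meagerComposant_inter_interior`). The equivalence relation is a
countable intersection of countable unions of closed sets and has meagre sections, so by
Kuratowski–Ulam it is meagre in `U × U`. Mycielski's theorem then yields continuum many pairwise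
inequivalent points. The upper bound is the cardinality of a compact metric space. -/

open Topology Filter

/-! ### Intersections of connected sets in a tree -/

/-- The intersection of any two preconnected subsets of `Z` is preconnected. -/
def InterPreconnected {E : Type*} [TopologicalSpace E] (Z : Set E) : Prop :=
  ∀ A ⊆ Z, ∀ B ⊆ Z, IsPreconnected A → IsPreconnected B → IsPreconnected (A ∩ B)

/-- A separation of `A ∩ Y` extends to one of `A`: join `L` to the side containing the common point
of `Y` and `L`. If `A` misses that point, it lies in `Y` or in `L`. -/
lemma IsPreconnected.inter_left_of_subset_union {E : Type*} [TopologicalSpace E] {Y L A : Set E}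
    (hY : IsClosed Y) (hL : IsClosed L) (hv : (Y ∩ L).Subsingleton) (hA : A ⊆ Y ∪ L)
    (hAc : IsPreconnected A) : IsPreconnected (A ∩ Y) := by
  have key : ∀ P Q : Set E, IsClosed P → IsClosed Q → A ∩ Y ⊆ P ∪ Q → A ∩ Y ∩ (P ∩ Q) = ∅ →
      ∀ v ∈ A, v ∈ Y → v ∈ L → v ∈ P → A ∩ Y ⊆ P := by
    intro P Q hP hQ hPQ hd v hvA hvY hvL hvP
    have h := isPreconnected_iff_subset_of_disjoint_closed.1 hAc ((P ∩ Y) ∪ L) (Q ∩ Y)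
      ((hP.inter hY).union hL) (hQ.inter hY) ?_ ?_
    · rcases h with h | h
      · rintro a ⟨haA, haY⟩
        rcases h haA with h' | h'
        · exact h'.1
        · rwa [hv ⟨haY, h'⟩ ⟨hvY, hvL⟩]
      · have : v ∈ A ∩ Y ∩ (P ∩ Q) := ⟨⟨hvA, hvY⟩, hvP, (h hvA).1⟩
        rw [hd] at this
        exact this.elim
    · intro a ha
      rcases hA ha with h' | h'
      · rcases hPQ ⟨ha, h'⟩ with h'' | h''
        · exact Or.inl (Or.inl ⟨h'', h'⟩)
        · exact Or.inr ⟨h'', h'⟩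
      · exact Or.inl (Or.inr h')
    · rw [eq_empty_iff_forall_notMem] at hd ⊢
      rintro a ⟨haA, h1, h2⟩
      rcases h1 with h1 | h1
      · exact hd a ⟨⟨haA, h1.2⟩, h1.1, h2.1⟩
      · have : a = v := hv ⟨h2.2, h1⟩ ⟨hvY, hvL⟩
        subst this
        exact hd a ⟨⟨haA, hvY⟩, hvP, h2.1⟩
  by_cases hne : (A ∩ (Y ∩ L)).Nonempty
  · obtain ⟨v, hvA, hvY, hvL⟩ := hne
    rw [isPreconnected_iff_subset_of_disjoint_closed]
    intro P Q hP hQ hPQ hd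
    rcases hPQ ⟨hvA, hvY⟩ with h | h
    · exact Or.inl (key P Q hP hQ hPQ hd v hvA hvY hvL h)
    · exact Or.inr (key Q P hQ hP (by rwa [union_comm]) (by rwa [inter_comm Q P])
        v hvA hvY hvL h)
  · rw [not_nonempty_iff_eq_empty] at hne
    rcases isPreconnected_iff_subset_of_disjoint_closed.1 hAc Y L hY hL hA hne with h | h
    · rwa [inter_eq_left.2 h]
    · have : A ∩ Y = ∅ := by
        rw [← hne]
        ext a
        exact ⟨fun ha => ⟨ha.1, ha.2, h ha.1⟩, fun ha => ⟨ha.1, ha.2.1⟩⟩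
      rw [this]
      exact isPreconnected_empty

lemma InterPreconnected.union {E : Type*} [TopologicalSpace E] {Y L : Set E}
    (hY : IsClosed Y) (hL : IsClosed L) (hv : (Y ∩ L).Subsingleton)
    (hYi : InterPreconnected Y) (hLi : InterPreconnected L) : InterPreconnected (Y ∪ L) := by
  intro A hA B hB hAc hBc
  have hv' : (L ∩ Y).Subsingleton := by rwa [inter_comm]
  have h1 : IsPreconnected ((A ∩ B) ∩ Y) := by
    rw [inter_inter_distrib_right]
    exact hYi _ inter_subset_right _ inter_subset_right
      (hAc.inter_left_of_subset_union hY hL hv hA) (hBc.inter_left_of_subset_union hY hL hv hB)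
  have h2 : IsPreconnected ((A ∩ B) ∩ L) := by
    rw [inter_inter_distrib_right]
    exact hLi _ inter_subset_right _ inter_subset_right
      (hAc.inter_left_of_subset_union hL hY hv' (by rwa [union_comm]))
      (hBc.inter_left_of_subset_union hL hY hv' (by rwa [union_comm]))
  have hU : A ∩ B = ((A ∩ B) ∩ Y) ∪ ((A ∩ B) ∩ L) := by
    rw [← inter_union_distrib_left, inter_eq_left.2 (inter_subset_left.trans hA)]
  have sub : ∀ C : Set E, C ⊆ Y ∪ L → IsPreconnected C → ¬ (C ∩ (Y ∩ L)).Nonempty →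
      C ⊆ Y ∨ C ⊆ L := fun C hC hCc hne =>
    isPreconnected_iff_subset_of_disjoint_closed.1 hCc Y L hY hL hC
      (not_nonempty_iff_eq_empty.1 hne)
  have fin : A ∩ B ⊆ Y ∨ A ∩ B ⊆ L → IsPreconnected (A ∩ B) := by
    rintro (h | h)
    · rwa [inter_eq_left.2 h] at h1
    · rwa [inter_eq_left.2 h] at h2
  by_cases hnA : (A ∩ (Y ∩ L)).Nonempty
  · by_cases hnB : (B ∩ (Y ∩ L)).Nonempty
    · obtain ⟨v, hvA, hvY⟩ := hnA
      obtain ⟨w, hwB, hwY⟩ := hnB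
      obtain rfl := hv hvY hwY
      rw [hU]
      exact IsPreconnected.union v ⟨⟨hvA, hwB⟩, hvY.1⟩ ⟨⟨hvA, hwB⟩, hvY.2⟩ h1 h2
    · exact fin ((sub B hB hBc hnB).imp inter_subset_right.trans inter_subset_right.trans)
  · exact fin ((sub A hA hAc hnA).imp inter_subset_left.trans inter_subset_left.trans)

/-- A coordinate separating `a` from `b` embeds the segment in `ℝ`, where preconnected means
order-convex. -/
lemma interPreconnected_segment {V : Type*} (a b : V → ℝ) :
    InterPreconnected (segment ℝ a b) := by
  intro A hA B hB hAc hBc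
  by_cases hab : a = b
  · subst hab
    rw [segment_same] at hA
    exact ((subsingleton_singleton.anti hA).anti inter_subset_left).isPreconnected
  obtain ⟨i, hi⟩ := Function.ne_iff.1 hab
  have hi' : b i - a i ≠ 0 := sub_ne_zero.2 (Ne.symm hi)
  let φ : (V → ℝ) → ℝ := fun p => (p i - a i) / (b i - a i)
  let g : ℝ → (V → ℝ) := fun t => a + t • (b - a)
  have hφ : Continuous φ := by fun_prop
  have hg : Continuous g := by fun_prop
  have hgφ : ∀ p ∈ segment ℝ a b, g (φ p) = p := by
    intro p hp
    rw [segment_eq_image'] at hp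
    obtain ⟨t, -, rfl⟩ := hp
    have : φ (a + t • (b - a)) = t := by
      simp only [φ, Pi.add_apply, Pi.smul_apply, Pi.sub_apply, smul_eq_mul]
      field_simp
      ring
    simp only [g, this]
  have hAB : A ∩ B = g '' (φ '' A ∩ φ '' B) := by
    ext p
    constructor
    · intro hp
      exact ⟨φ p, ⟨mem_image_of_mem _ hp.1, mem_image_of_mem _ hp.2⟩, hgφ p (hA hp.1)⟩
    · rintro ⟨t, ⟨⟨p, hp, rfl⟩, ⟨q, hq, hqp⟩⟩, rfl⟩
      have h2 := hgφ q (hB hq)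
      rw [hqp, hgφ p (hA hp)] at h2
      rw [hgφ p (hA hp)]
      exact ⟨hp, h2 ▸ hq⟩
  rw [hAB]
  refine IsPreconnected.image ?_ _ hg.continuousOn
  have h1 := (hAc.image φ hφ.continuousOn).ordConnected
  have h2 := (hBc.image φ hφ.continuousOn).ordConnected
  exact (h1.inter h2).isPreconnected

/-- Take `u` farthest from a root. A neighbour in `S` is one step closer, so it is the penultimate
vertex of the unique path from the root to `u`. -/
lemma SimpleGraph.IsTree.exists_subsingleton_adj {V : Type*} {G : SimpleGraph V} (hG : G.IsTree)
    (S : Finset V) (hS : S.Nonempty) : ∃ u ∈ S, {w | w ∈ S ∧ G.Adj u w}.Subsingleton := by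
  obtain ⟨r, -⟩ := id hS
  obtain ⟨u, huS, hu⟩ := S.exists_max_image (fun v => G.dist r v) hS
  refine ⟨u, huS, ?_⟩
  have key : ∀ w ∈ S, G.Adj u w →
      ∃ p : G.Walk r u, p.IsPath ∧ p.penultimate = w := by
    intro w hw huw
    have hd : G.dist r u = G.dist r w + 1 := by
      have := hu w hw
      rcases hG.dist_eq_dist_add_one_of_adj r huw with h | h <;> omega
    obtain ⟨p, hp⟩ := (hG.1 r w).exists_walk_length_eq_dist
    refine ⟨p.concat huw.symm, ?_, by simp⟩
    apply SimpleGraph.Walk.isPath_of_length_eq_dist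
    rw [SimpleGraph.Walk.length_concat, hp, hd]
  rintro w ⟨hw, huw⟩ w' ⟨hw', huw'⟩
  obtain ⟨p, hp, rfl⟩ := key w hw huw
  obtain ⟨q, hq, rfl⟩ := key w' hw' huw'
  rw [(hG.existsUnique_path r u).unique hp hq]

/-- The part of the realization of `G` spanned by the vertices in `S`. -/
def partialRealization {V : Type*} [DecidableEq V] (G : SimpleGraph V) (S : Finset V) :
    Set (V → ℝ) :=
  {p | (∃ v ∈ S, p = Pi.single v 1) ∨
    ∃ v ∈ S, ∃ w ∈ S, G.Adj v w ∧ p ∈ segment ℝ (Pi.single v (1 : ℝ)) (Pi.single w (1 : ℝ))}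

lemma isClosed_segment_pi {V : Type*} (a b : V → ℝ) : IsClosed (segment ℝ a b) := by
  rw [segment_eq_image']
  exact (isCompact_Icc.image (by fun_prop)).isClosed

lemma isClosed_partialRealization {V : Type*} [DecidableEq V] (G : SimpleGraph V)
    (S : Finset V) : IsClosed (partialRealization G S) := by
  have : partialRealization G S = (⋃ v ∈ S, {Pi.single v 1}) ∪
      ⋃ v ∈ S, ⋃ w ∈ S, ⋃ _ : G.Adj v w,
        segment ℝ (Pi.single v (1 : ℝ)) (Pi.single w (1 : ℝ)) := by
    ext p
    simp only [partialRealization, mem_ofPred_eq, mem_union, mem_iUnion, mem_singleton_iff,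
      exists_prop]
  rw [this]
  refine (S.finite_toSet.isClosed_biUnion fun v _ => isClosed_singleton).union
    (S.finite_toSet.isClosed_biUnion fun v _ => S.finite_toSet.isClosed_biUnion fun w _ => ?_)
  by_cases h : G.Adj v w
  · simpa [h] using isClosed_segment_pi _ _
  · simp [h]

lemma eq_zero_of_mem_partialRealization {V : Type*} [DecidableEq V] {G : SimpleGraph V}
    {S : Finset V} {u : V} (hu : u ∉ S) {p : V → ℝ} (hp : p ∈ partialRealization G S) :
    p u = 0 := by
  have hne : ∀ v ∈ S, u ≠ v := fun v hv h => hu (h ▸ hv)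
  rcases hp with ⟨v, hv, rfl⟩ | ⟨v, hv, w, hw, -, hp⟩
  · simp [hne v hv]
  · obtain ⟨a, b, -, -, -, rfl⟩ := hp
    simp [hne v hv, hne w hw]

/-- Induction on a subforest, not necessarily connected: removing `u` as above removes one segment
attached in at most one point. -/
lemma interPreconnected_partialRealization {V : Type*} [DecidableEq V] {G : SimpleGraph V}
    (hG : G.IsTree) (S : Finset V) : InterPreconnected (partialRealization G S) := by
  induction hn : S.card generalizing S with
  | zero =>
    rw [Finset.card_eq_zero] at hn
    subst hn
    intro A hA B _ _ _
    have : A = ∅ := by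
      rw [eq_empty_iff_forall_notMem]
      intro a ha
      simpa [partialRealization] using hA ha
    rw [this, empty_inter]
    exact isPreconnected_empty
  | succ n ih =>
    obtain ⟨u, huS, hu⟩ := hG.exists_subsingleton_adj S (Finset.card_pos.1 (by omega))
    have hih := ih (S.erase u) (by rw [Finset.card_erase_of_mem huS]; omega)
    have hsub : partialRealization G (S.erase u) ⊆ partialRealization G S := by
      rintro p (⟨v, hv, rfl⟩ | ⟨v, hv, w, hw, hvw, hp⟩)
      · exact Or.inl ⟨v, Finset.mem_of_mem_erase hv, rfl⟩
      · exact Or.inr ⟨v, Finset.mem_of_mem_erase hv, w, Finset.mem_of_mem_erase hw, hvw, hp⟩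
    have huu : (Pi.single u 1 : V → ℝ) ∈ partialRealization G S := Or.inl ⟨u, huS, rfl⟩
    -- the branch at `u`, a point if `u` is isolated in `S`
    obtain ⟨v, hv, hvu, hcov⟩ : ∃ v : V, (v ≠ u ∨ ∀ w ∈ S, ¬ G.Adj u w) ∧
        segment ℝ (Pi.single u (1 : ℝ)) (Pi.single v (1 : ℝ)) ⊆ partialRealization G S ∧
        ∀ w ∈ S, G.Adj u w → w = v := by
      by_cases h : ∃ w ∈ S, G.Adj u w
      · obtain ⟨w, hw, huw⟩ := h
        exact ⟨w, Or.inl huw.ne', fun p hp => Or.inr ⟨u, huS, w, hw, huw, hp⟩,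
          fun w' hw' h' => hu ⟨hw', h'⟩ ⟨hw, huw⟩⟩
      · push Not at h
        refine ⟨u, Or.inr h, ?_, fun w hw huw => (h w hw huw).elim⟩
        rw [segment_same]
        exact singleton_subset_iff.2 huu
    have hEq : partialRealization G S = partialRealization G (S.erase u) ∪
        segment ℝ (Pi.single u (1 : ℝ)) (Pi.single v (1 : ℝ)) := by
      refine Subset.antisymm ?_ (union_subset hsub hvu)
      rintro p (⟨w, hw, rfl⟩ | ⟨w, hw, w', hw', hadj, hp⟩)
      · by_cases hwu : w = u
        · subst hwu
          exact Or.inr (left_mem_segment ℝ _ _)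
        · exact Or.inl (Or.inl ⟨w, Finset.mem_erase.2 ⟨hwu, hw⟩, rfl⟩)
      · by_cases hwu : w = u
        · subst hwu
          rw [hcov w' hw' hadj] at hp
          exact Or.inr hp
        by_cases hwu' : w' = u
        · subst hwu'
          rw [hcov w hw hadj.symm, segment_symm] at hp
          exact Or.inr hp
        exact Or.inl (Or.inr ⟨w, Finset.mem_erase.2 ⟨hwu, hw⟩, w',
          Finset.mem_erase.2 ⟨hwu', hw'⟩, hadj, hp⟩)
    rw [hEq]
    refine InterPreconnected.union (isClosed_partialRealization _ _) (isClosed_segment_pi _ _) ?_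
      hih (interPreconnected_segment _ _)
    -- The coordinate at `u` vanishes on the smaller realization; on a nondegenerate branch this
    -- leaves only the end `v`.
    have key : ∀ p ∈ partialRealization G (S.erase u) ∩
        segment ℝ (Pi.single u (1 : ℝ)) (Pi.single v (1 : ℝ)), p = Pi.single v 1 := by
      rintro p ⟨hp, a, b, -, -, hab, rfl⟩
      have h0 := eq_zero_of_mem_partialRealization (Finset.notMem_erase u S) hp
      by_cases huv : u = v
      · subst huv
        rw [← add_smul, hab, one_smul]
      · simp [huv] at h0
        subst h0
        simp at hab
        simp [hab]
    intro p hp q hq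
    rw [key p hp, key q hq]

lemma interPreconnected_graphRealization {V : Type*} [Fintype V] [DecidableEq V]
    {G : SimpleGraph V} (hG : G.IsTree) : InterPreconnected (graphRealization G) := by
  have : graphRealization G = partialRealization G Finset.univ := by
    ext p
    simp [graphRealization, partialRealization]
  rw [this]
  exact interPreconnected_partialRealization hG _

/-! ### Tree-like continua are hereditarily unicoherent -/

lemma exists_pos_forall_le_dist {X : Type*} [MetricSpace X] [CompactSpace X] {A B : Set X}
    (hA : IsClosed A) (hB : IsClosed B) (h : Disjoint A B) :
    ∃ ε : ℝ, 0 < ε ∧ ∀ a ∈ A, ∀ b ∈ B, ε ≤ dist a b := by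
  obtain ⟨ε, hε, hd⟩ := h.exists_thickenings hA.isCompact hB
  refine ⟨ε, hε, fun a ha b hb => ?_⟩
  by_contra! hlt
  refine disjoint_left.1 hd (Metric.mem_thickening_iff.2 ⟨a, ha, ?_⟩)
    (Metric.self_subset_thickening hε B hb)
  rwa [dist_comm]

/-- A separation of `A ∩ B` would pass to the intersection of the images of `A` and `B` in a tree,
as a map with small fibres identifies only nearby points. -/
theorem IsTreeLike.isPreconnected_inter {X : Type*} [MetricSpace X] [CompactSpace X]
    (hX : IsTreeLike X) {A B : Set X} (hA : IsClosed A) (hB : IsClosed B)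
    (hAc : IsPreconnected A) (hBc : IsPreconnected B) : IsPreconnected (A ∩ B) := by
  rw [isPreconnected_iff_subset_of_fully_disjoint_closed (hA.inter hB)]
  intro u v hu hv huv hd
  by_contra! hcon
  obtain ⟨⟨q, ⟨hqA, hqB⟩, hqu⟩, p, ⟨hpA, hpB⟩, hpv⟩ :=
    hcon.imp not_subset.1 not_subset.1
  have hqv : q ∈ v := (huv ⟨hqA, hqB⟩).resolve_left hqu
  have hpu : p ∈ u := (huv ⟨hpA, hpB⟩).resolve_right hpv
  obtain ⟨δ, hδ, hδd⟩ := hd.exists_cthickenings hu.isCompact hv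
  obtain ⟨ε₁, hε₁, h₁⟩ := exists_pos_forall_le_dist Metric.isClosed_cthickening
    Metric.isClosed_cthickening hδd
  obtain ⟨ε₂, hε₂, h₂⟩ := exists_pos_forall_le_dist
    (A := A \ (Metric.thickening δ u ∪ Metric.thickening δ v)) (B := B)
    (hA.sdiff (Metric.isOpen_thickening.union Metric.isOpen_thickening)) hB (by
      rw [disjoint_left]
      rintro a ⟨haA, hna⟩ haB
      exact hna ((huv ⟨haA, haB⟩).imp (fun h => Metric.self_subset_thickening hδ _ h)
        (fun h => Metric.self_subset_thickening hδ _ h)))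
  -- The bound `ε₁` keeps the images of the two thickenings disjoint; `ε₂` forces any `a ∈ A`
  -- sharing its image with a point of `B` into one of them.
  obtain ⟨n, T, f, hT, hf, hfib⟩ := hX (min ε₁ ε₂) (lt_min hε₁ hε₂)
  have hdist : ∀ a b, (f a : Fin n → ℝ) = f b → dist a b < min ε₁ ε₂ := fun a b hab =>
    (Metric.dist_le_diam_of_mem Metric.isBounded_of_compactSpace
      (show a ∈ f ⁻¹' {f b} from Subtype.ext hab) (show b ∈ f ⁻¹' {f b} from rfl)).trans_lt
      (hfib (f b))
  let F : X → (Fin n → ℝ) := fun x => f x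
  have hF : Continuous F := continuous_subtype_val.comp hf
  have hcl : ∀ C : Set X, IsClosed C → IsClosed (F '' C) := fun C hC =>
    (hC.isCompact.image hF).isClosed
  have hsub : ∀ C : Set X, F '' C ⊆ graphRealization T := by
    rintro C _ ⟨c, -, rfl⟩
    exact (f c).2
  have hpre := interPreconnected_graphRealization hT (F '' A) (hsub A) (F '' B) (hsub B)
    (hAc.image F hF.continuousOn) (hBc.image F hF.continuousOn)
  have hfar : ∀ x ∈ Metric.cthickening δ u, ∀ y ∈ Metric.cthickening δ v, F x ≠ F y :=
    fun x hx y hy hxy => ((hdist x y hxy).trans_le (min_le_left _ _)).not_ge (h₁ x hx y hy)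
  rcases isPreconnected_iff_subset_of_disjoint_closed.1 hpre _ _
    (hcl _ (Metric.isClosed_cthickening (δ := δ) (E := u)))
    (hcl _ (Metric.isClosed_cthickening (δ := δ) (E := v))) (by
      rintro _ ⟨⟨a, ha, rfl⟩, b, hb, hab⟩
      have : a ∈ Metric.thickening δ u ∪ Metric.thickening δ v := by
        by_contra hna
        exact ((hdist a b hab.symm).trans_le (min_le_right _ _)).not_ge (h₂ a ⟨ha, hna⟩ b hb)
      exact this.imp (fun h => mem_image_of_mem _ (Metric.thickening_subset_cthickening _ _ h))
        (fun h => mem_image_of_mem _ (Metric.thickening_subset_cthickening _ _ h))) (by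
      rw [eq_empty_iff_forall_notMem]
      rintro _ ⟨-, ⟨x, hx, rfl⟩, y, hy, hxy⟩
      exact hfar x hx y hy hxy.symm) with h | h
  · obtain ⟨x, hx, hxq⟩ := h ⟨mem_image_of_mem F hqA, mem_image_of_mem F hqB⟩
    exact hfar x hx q (Metric.self_subset_cthickening _ hqv) hxq
  · obtain ⟨y, hy, hyp⟩ := h ⟨mem_image_of_mem F hpA, mem_image_of_mem F hpB⟩
    exact hfar p (Metric.self_subset_cthickening _ hpu) y hy hyp.symm

/-! ### Baire category: Kuratowski–Ulam and Mycielski -/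

/-- The easy half of the Kuratowski–Ulam theorem. -/
theorem eventually_residual_prodMk_preimage {Y Z : Type*} [TopologicalSpace Y]
    [TopologicalSpace Z] [SecondCountableTopology Z] {A : Set (Y × Z)} (hA : A ∈ residual (Y × Z)) :
    ∀ᶠ y in residual Y, Prod.mk y ⁻¹' A ∈ residual Z := by
  obtain ⟨S, hSo, hSd, hSc, hSA⟩ := mem_residual_iff.1 hA
  have key : ∀ D ∈ S, ∀ᶠ y in residual Y, Dense (Prod.mk y ⁻¹' D) := by
    intro D hD
    have hb := TopologicalSpace.isBasis_countableBasis Z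
    have : ∀ W ∈ TopologicalSpace.countableBasis Z,
        ∀ᶠ y in residual Y, (W ∩ Prod.mk y ⁻¹' D).Nonempty := by
      intro W hW
      have hWo := hb.isOpen hW
      have hWne := TopologicalSpace.nonempty_of_mem_countableBasis hW
      -- As a projection of an open set this is open; density of `D` makes it dense.
      have hEq : {y | (W ∩ Prod.mk y ⁻¹' D).Nonempty} = Prod.fst '' (D ∩ (univ ×ˢ W)) := by
        ext y
        constructor
        · rintro ⟨z, hzW, hzD⟩
          exact ⟨(y, z), ⟨hzD, mem_univ _, hzW⟩, rfl⟩
        · rintro ⟨⟨y, z⟩, ⟨hzD, -, hzW⟩, rfl⟩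
          exact ⟨z, hzW, hzD⟩
      refine residual_of_dense_open (s := {y | (W ∩ Prod.mk y ⁻¹' D).Nonempty}) ?_ ?_
      · rw [hEq]
        exact isOpenMap_fst _ ((hSo D hD).inter (isOpen_univ.prod hWo))
      · rw [dense_iff_inter_open]
        intro O hO hOne
        obtain ⟨⟨y, z⟩, ⟨hy, hz⟩, hyz⟩ :=
          (hSd D hD).inter_open_nonempty _ (hO.prod hWo) (hOne.prod hWne)
        exact ⟨y, hy, z, hz, hyz⟩
    have h2 := (eventually_countable_ball (TopologicalSpace.countable_countableBasis Z)).2 this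
    filter_upwards [h2] with y hy
    rw [hb.dense_iff]
    rintro W hW -
    exact hy W hW
  filter_upwards [(eventually_countable_ball hSc).2 key] with y hy
  rw [mem_residual_iff]
  refine ⟨(fun D => Prod.mk y ⁻¹' D) '' S, ?_, ?_, hSc.image _, ?_⟩
  · rintro _ ⟨D, hD, rfl⟩
    exact (hSo D hD).preimage (by fun_prop)
  · rintro _ ⟨D, hD, rfl⟩
    exact hy D hD
  · intro z hz
    refine hSA fun D hD => ?_
    exact hz _ (mem_image_of_mem _ hD)

/-- A Baire measurable relation all of whose sections are meagre is meagre. -/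
theorem compl_mem_residual_of_forall_section {Y : Type*} [TopologicalSpace Y] [BaireSpace Y]
    [SecondCountableTopology Y] {R : Set (Y × Y)} (hR : BaireMeasurableSet R)
    (hs : ∀ y, IsMeagre (Prod.mk y ⁻¹' R)) : Rᶜ ∈ residual (Y × Y) := by
  obtain ⟨O, hO, hRO⟩ := hR.residualEq_isOpen
  have hres : {p | p ∈ R ↔ p ∈ O} ∈ residual (Y × Y) := by
    filter_upwards [hRO] with p hp
    exact iff_of_eq hp
  -- If `O` contained a box `V ×ˢ W`, a generic section of `R` over `V` would be comeagre in `W` as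
  -- well as meagre.
  suffices O = ∅ by
    subst this
    filter_upwards [hres] with p hp
    simpa using hp
  by_contra hne
  obtain ⟨⟨a, b⟩, hab⟩ := nonempty_iff_ne_empty.2 hne
  obtain ⟨V, W, hV, hW, haV, hbW, hVW⟩ := isOpen_prod_iff.1 hO a b hab
  have hgen := dense_of_mem_residual (eventually_residual_prodMk_preimage hres)
  obtain ⟨y, hyV, hy⟩ := hgen.inter_open_nonempty V hV ⟨a, haV⟩
  have h2 := dense_of_mem_residual (inter_mem hy (hs y))
  obtain ⟨z, hzW, hz, hzR⟩ := h2.inter_open_nonempty W hW ⟨b, hbW⟩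
  exact hzR (hz.2 (hVW ⟨hyV, hzW⟩))

/-- Each pair `i ≠ j` imposes a dense open condition on `ι → Y`, and finitely many such conditions
meet every open box. -/
lemma exists_forall_ne_prod_subset {Y ι : Type*} [TopologicalSpace Y] [Finite ι]
    {D : Set (Y × Y)} (hDo : IsOpen D) (hD : Dense D) (V : ι → Set Y)
    (hVo : ∀ i, IsOpen (V i)) (hVne : ∀ i, (V i).Nonempty) :
    ∃ y : ι → Y, (∀ i, y i ∈ V i) ∧ ∀ i j, i ≠ j → (y i, y j) ∈ D := by
  classical
  have hpair : ∀ i j : ι, i ≠ j →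
      IsOpen {y : ι → Y | (y i, y j) ∈ D} ∧ Dense {y : ι → Y | (y i, y j) ∈ D} := by
    intro i j hij
    refine ⟨hDo.preimage (by fun_prop), ?_⟩
    rw [dense_iff_inter_open]
    rintro U hU ⟨y, hy⟩
    obtain ⟨I, u, hu, huU⟩ := isOpen_pi_iff.1 hU y hy
    have hO : ∀ k : ι, ∃ O : Set Y, IsOpen O ∧ y k ∈ O ∧ (k ∈ I → O ⊆ u k) := by
      intro k
      by_cases hk : k ∈ I
      · exact ⟨u k, (hu k hk).1, (hu k hk).2, fun _ => Subset.rfl⟩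
      · exact ⟨univ, isOpen_univ, mem_univ _, fun h => (hk h).elim⟩
    choose O hOo hyO hOu using hO
    obtain ⟨⟨a, b⟩, ⟨ha, hb⟩, hab⟩ := hD.inter_open_nonempty _ ((hOo i).prod (hOo j))
      ⟨(y i, y j), hyO i, hyO j⟩
    refine ⟨Function.update (Function.update y i a) j b, huU ?_, ?_⟩
    · intro k hk
      by_cases hkj : k = j
      · subst hkj
        simpa using hOu k hk hb
      · rw [Function.update_of_ne hkj]
        by_cases hki : k = i
        · subst hki
          simpa using hOu k hk ha
        · rw [Function.update_of_ne hki]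
          exact hOu k hk (hyO k)
    · simpa [hij] using hab
  have hall : ∀ s : Finset (ι × ι), (∀ p ∈ s, p.1 ≠ p.2) →
      IsOpen {y : ι → Y | ∀ p ∈ s, (y p.1, y p.2) ∈ D} ∧
      Dense {y : ι → Y | ∀ p ∈ s, (y p.1, y p.2) ∈ D} := by
    intro s
    induction s using Finset.induction_on with
    | empty => simp
    | insert p s hp ih =>
      intro hs
      have h1 := ih fun q hq => hs q (Finset.mem_insert_of_mem hq)
      have h2 := hpair p.1 p.2 (hs p (Finset.mem_insert_self _ _))
      have : {y : ι → Y | ∀ q ∈ insert p s, (y q.1, y q.2) ∈ D} =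
          {y : ι → Y | (y p.1, y p.2) ∈ D} ∩ {y : ι → Y | ∀ q ∈ s, (y q.1, y q.2) ∈ D} := by
        ext y
        simp
      rw [this]
      exact ⟨h2.1.inter h1.1, h2.2.inter_of_isOpen_left h1.2 h2.1⟩
  have := Fintype.ofFinite ι
  have h := (hall (Finset.univ.filter fun p : ι × ι => p.1 ≠ p.2) (by simp)).2
  choose y hy using hVne
  obtain ⟨z, hzV, hz⟩ := h.inter_open_nonempty (univ.pi V)
    (isOpen_set_pi finite_univ fun i _ => hVo i) ⟨y, fun i _ => hy i⟩
  exact ⟨z, fun i => hzV i (mem_univ i), fun i j hij => hz (i, j) (by simpa using hij)⟩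

/-- One stage of the Cantor scheme in Mycielski's theorem. -/
lemma exists_refinement {Y ι : Type*} [TopologicalSpace Y] [LocallyCompactSpace Y] [T2Space Y]
    [Finite ι] {D : Set (Y × Y)} (hDo : IsOpen D) (hD : Dense D) (V : ι → Set Y)
    (hVo : ∀ i, IsOpen (V i)) (hVne : ∀ i, (V i).Nonempty) :
    ∃ V' : ι → Set Y, (∀ i, IsOpen (V' i)) ∧ (∀ i, (V' i).Nonempty) ∧
      (∀ i, IsCompact (closure (V' i))) ∧ (∀ i, closure (V' i) ⊆ V i) ∧
      ∀ i j, i ≠ j → V' i ×ˢ V' j ⊆ D := by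
  obtain ⟨y, hyV, hy⟩ := exists_forall_ne_prod_subset hDo hD V hVo hVne
  have h1 : ∀ i j, ∃ A B : Set Y, IsOpen A ∧ IsOpen B ∧ y i ∈ A ∧ y j ∈ B ∧
      (i ≠ j → A ×ˢ B ⊆ D) := by
    intro i j
    by_cases hij : i = j
    · exact ⟨univ, univ, isOpen_univ, isOpen_univ, mem_univ _, mem_univ _, fun h => (h hij).elim⟩
    · obtain ⟨A, B, hA, hB, hyA, hyB, hAB⟩ := isOpen_prod_iff.1 hDo _ _ (hy i j hij)
      exact ⟨A, B, hA, hB, hyA, hyB, fun _ => hAB⟩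
  choose A B hA hB hyA hyB hAB using h1
  have h2 : ∀ i, ∃ O : Set Y, IsOpen O ∧ y i ∈ O ∧ closure O ⊆ V i ∧ IsCompact (closure O) := by
    intro i
    obtain ⟨O, hO, hyO, hOV, hOc⟩ := exists_open_between_and_isCompact_closure
      (isCompact_singleton (x := y i)) (hVo i) (singleton_subset_iff.2 (hyV i))
    exact ⟨O, hO, hyO rfl, hOV, hOc⟩
  choose O hO hyO hOV hOc using h2
  have hsub : ∀ i, O i ∩ ((⋂ j, A i j) ∩ ⋂ j, B j i) ⊆ O i := fun i => inter_subset_left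
  refine ⟨fun i => O i ∩ ((⋂ j, A i j) ∩ ⋂ j, B j i), fun i => (hO i).inter
    ((isOpen_iInter_of_finite fun j => hA i j).inter (isOpen_iInter_of_finite fun j => hB j i)),
    fun i => ⟨y i, hyO i, mem_iInter.2 fun j => hyA i j, mem_iInter.2 fun j => hyB j i⟩,
    fun i => (hOc i).of_isClosed_subset isClosed_closure (closure_mono (hsub i)),
    fun i => (closure_mono (hsub i)).trans (hOV i), ?_⟩
  rintro i j hij ⟨a, b⟩ ⟨⟨-, ha, -⟩, -, -, hb⟩
  exact hAB i j hij ⟨mem_iInter.1 ha j, mem_iInter.1 hb i⟩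

/-- Mycielski's theorem: a comeagre relation admits a Cantor set of pairwise related points. -/
theorem exists_forall_ne_mem_of_mem_residual {Y : Type*} [TopologicalSpace Y]
    [LocallyCompactSpace Y] [T2Space Y] [Nonempty Y] {R : Set (Y × Y)}
    (hR : R ∈ residual (Y × Y)) :
    ∃ f : (ℕ → Bool) → Y, ∀ a b, a ≠ b → (f a, f b) ∈ R := by
  obtain ⟨S, hSo, hSd, hSc, hSR⟩ := mem_residual_iff.1 hR
  -- Inserting `univ` makes the family nonempty, so `ℕ` enumerates it.
  obtain ⟨D, hD⟩ := (hSc.insert univ).exists_eq_range (insert_nonempty _ _)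
  have hDS : ∀ n, IsOpen (D n) ∧ Dense (D n) := by
    intro n
    have : D n ∈ insert univ S := hD ▸ mem_range_self n
    rcases this with h | h
    · rw [h]
      exact ⟨isOpen_univ, dense_univ⟩
    · exact ⟨hSo _ h, hSd _ h⟩
  let Q (n : ℕ) := {V : (Fin n → Bool) → Set Y // ∀ s, IsOpen (V s) ∧ (V s).Nonempty}
  -- Unpairing `n` makes each `D k` recur at infinitely many stages.
  have hstep : ∀ n (V : Q n), ∃ V' : Q (n + 1),
      (∀ s, IsCompact (closure (V'.1 s))) ∧
      (∀ s, closure (V'.1 s) ⊆ V.1 fun k => s k.castSucc) ∧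
      ∀ s t, s ≠ t → V'.1 s ×ˢ V'.1 t ⊆ D n.unpair.1 := by
    intro n V
    obtain ⟨V', h1, h2, h3, h4, h5⟩ := exists_refinement (hDS n.unpair.1).1 (hDS n.unpair.1).2
      (fun s : Fin (n + 1) → Bool => V.1 fun k => s k.castSucc) (fun s => (V.2 _).1)
      (fun s => (V.2 _).2)
    exact ⟨⟨V', fun s => ⟨h1 s, h2 s⟩⟩, h3, h4, h5⟩
  choose step hc hsub hpair using hstep
  let V : ∀ n, Q n := fun n =>
    Nat.rec ⟨fun _ => univ, fun _ => ⟨isOpen_univ, univ_nonempty⟩⟩ (fun n V => step n V) n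
  let C : (ℕ → Bool) → ℕ → Set Y := fun a n => (V n).1 fun k => a k
  have hCsub : ∀ a n, closure (C a (n + 1)) ⊆ C a n := fun a n => hsub n (V n) _
  have hCne : ∀ a, (⋂ n, closure (C a (n + 1))).Nonempty := by
    intro a
    refine IsCompact.nonempty_iInter_of_sequence_nonempty_isCompact_isClosed _
      (fun n => (hCsub a (n + 1)).trans subset_closure)
      (fun n => (((V (n + 1)).2 _).2).closure) (hc 0 (V 0) _) (fun n => isClosed_closure)
  choose f hf using hCne
  have hfC : ∀ a n, f a ∈ C a n := fun a n => hCsub a n (mem_iInter.1 (hf a) n)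
  refine ⟨f, fun a b hab => hSR fun E hE => ?_⟩
  obtain ⟨k, rfl⟩ : E ∈ range D := hD ▸ mem_insert_of_mem _ hE
  obtain ⟨m, hm⟩ := Function.ne_iff.1 hab
  -- Stage `Nat.pair k m` treats `D k`, and its words, of length `Nat.pair k m + 1`, already include
  -- the place `m` where `a` and `b` differ.
  have hle : m ≤ Nat.pair k m := Nat.right_le_pair k m
  have h := hpair (Nat.pair k m) (V _) (fun i => a i) (fun i => b i)
    (fun h => hm (congrFun h ⟨m, by omega⟩))
  rw [Nat.unpair_pair] at h
  exact h ⟨hfC a (Nat.pair k m + 1), hfC b (Nat.pair k m + 1)⟩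

/-! ### Continuum hulls and components of complements -/

/-- A space is hereditarily unicoherent if the intersection of any two of its closed connected
subsets is connected or empty. -/
def HereditarilyUnicoherent (X : Type*) [TopologicalSpace X] : Prop :=
  ∀ A B : Set X, IsClosed A → IsClosed B → IsPreconnected A → IsPreconnected B →
    IsPreconnected (A ∩ B)

/-- The intersection of all closed connected sets containing `x` and `y`. -/
def continuumHull {X : Type*} [TopologicalSpace X] (x y : X) : Set X :=
  ⋂₀ {K : Set X | IsClosed K ∧ IsPreconnected K ∧ x ∈ K ∧ y ∈ K}

/-- By compactness, disjoint open neighbourhoods of the two pieces already cover some member `K`. -/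
lemma isPreconnected_sInter_of_directedOn {X : Type*} [TopologicalSpace X] [CompactSpace X]
    [T2Space X] {S : Set (Set X)} (hne : S.Nonempty) (hS : DirectedOn (· ⊇ ·) S)
    (hc : ∀ K ∈ S, IsClosed K) (hp : ∀ K ∈ S, IsPreconnected K) : IsPreconnected (⋂₀ S) := by
  rw [isPreconnected_iff_subset_of_fully_disjoint_closed (isClosed_sInter hc)]
  intro u v hu hv huv hd
  obtain ⟨U, V, hU, hV, huU, hvV, hUV⟩ := normal_separation hu hv hd
  have := hne.to_subtype
  obtain ⟨K, hK⟩ := exists_subset_nhds_of_isCompact (V := fun K : S => (K : Set X))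
    (U := U ∪ V) hS.directed_val (fun K => (hc K K.2).isCompact) (by
      intro x hx
      rw [← sInter_eq_iInter] at hx
      exact (hU.union hV).mem_nhds ((huv hx).imp (@huU x) (@hvV x)))
  have hsub : ⋂₀ S ⊆ K := sInter_subset_of_mem K.2
  rcases isPreconnected_iff_subset_of_disjoint.1 (hp K K.2) U V hU hV hK
    (by rw [hUV.inter_eq, inter_empty]) with h | h
  · exact Or.inl fun x hx => (huv hx).resolve_right fun hxv =>
      disjoint_left.1 hUV (h (hsub hx)) (hvV hxv)
  · exact Or.inr fun x hx => (huv hx).resolve_left fun hxu =>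
      disjoint_left.1 hUV (huU hxu) (h (hsub hx))

section Hull

variable {X : Type*} [TopologicalSpace X]

lemma left_mem_continuumHull (x y : X) : x ∈ continuumHull x y := fun _ hK => hK.2.2.1

lemma right_mem_continuumHull (x y : X) : y ∈ continuumHull x y := fun _ hK => hK.2.2.2

lemma isClosed_continuumHull (x y : X) : IsClosed (continuumHull x y) :=
  isClosed_sInter fun _ hK => hK.1

lemma continuumHull_subset {x y : X} {K : Set X} (hK : IsClosed K) (hKp : IsPreconnected K)
    (hx : x ∈ K) (hy : y ∈ K) : continuumHull x y ⊆ K :=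
  sInter_subset_of_mem ⟨hK, hKp, hx, hy⟩

lemma continuumHull_comm (x y : X) : continuumHull x y = continuumHull y x := by
  unfold continuumHull
  congr 1
  ext K
  exact and_congr_right fun _ => and_congr_right fun _ => and_comm

lemma interior_continuumHull_self [T2Space X] [ConnectedSpace X] [Nontrivial X] (x : X) :
    interior (continuumHull x x) = ∅ :=
  subset_empty_iff.1 ((interior_mono (continuumHull_subset isClosed_singleton
    isPreconnected_singleton rfl rfl)).trans (interior_singleton x).subset)

variable [CompactSpace X] [T2Space X]

/-- The relation of lying in the same component of the complement of `W` is closed. -/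
lemma isClosed_setOf_mem_connectedComponentIn_compl {W : Set X} (hW : IsOpen W) :
    IsClosed {p : X × X | p.1 ∉ W ∧ p.2 ∈ connectedComponentIn Wᶜ p.1} := by
  have hcp : CompactSpace ↥Wᶜ := isCompact_iff_compactSpace.1 hW.isClosed_compl.isCompact
  -- The space of components of a compact Hausdorff space is Hausdorff.
  have h1 : IsClosed {p : ↥Wᶜ × ↥Wᶜ | (p.2 : ConnectedComponents ↥Wᶜ) = p.1} :=
    isClosed_eq (ConnectedComponents.continuous_coe.comp continuous_snd)
      (ConnectedComponents.continuous_coe.comp continuous_fst)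
  have h2 := h1.isCompact.image (f := fun p : ↥Wᶜ × ↥Wᶜ => ((p.1 : X), (p.2 : X))) (by fun_prop)
  convert h2.isClosed using 1
  ext ⟨a, b⟩
  constructor
  · rintro ⟨ha, hb⟩
    rw [connectedComponentIn_eq_image (show a ∈ Wᶜ from ha)] at hb
    obtain ⟨b, hb, rfl⟩ := hb
    exact ⟨(⟨a, ha⟩, b), ConnectedComponents.coe_eq_coe'.2 hb, rfl⟩
  · rintro ⟨⟨a', b'⟩, hab, heq⟩
    obtain ⟨rfl, rfl⟩ := Prod.mk.inj heq
    refine ⟨a'.2, ?_⟩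
    rw [connectedComponentIn_eq_image a'.2]
    exact mem_image_of_mem _ (ConnectedComponents.coe_eq_coe'.1 hab)

lemma isClosed_connectedComponentIn_compl {W : Set X} (hW : IsOpen W) (x : X) :
    IsClosed (connectedComponentIn Wᶜ x) := by
  by_cases hx : x ∈ W
  · rw [connectedComponentIn_eq_empty (notMem_compl_iff.2 hx)]
    exact isClosed_empty
  · have h := (isClosed_setOf_mem_connectedComponentIn_compl hW).preimage
      (f := fun y => (x, y)) (by fun_prop)
    convert h using 1
    ext y
    simp [hx]

variable [ConnectedSpace X]

lemma HereditarilyUnicoherent.isPreconnected_continuumHull (hX : HereditarilyUnicoherent X)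
    (x y : X) : IsPreconnected (continuumHull x y) := by
  refine isPreconnected_sInter_of_directedOn
    ⟨univ, isClosed_univ, isPreconnected_univ, mem_univ _, mem_univ _⟩ ?_
    (fun K hK => hK.1) (fun K hK => hK.2.1)
  intro A hA B hB
  exact ⟨A ∩ B, ⟨hA.1.inter hB.1, hX A B hA.1 hB.1 hA.2.1 hB.2.1, ⟨hA.2.2.1, hB.2.2.1⟩,
    hA.2.2.2, hB.2.2.2⟩, inter_subset_left, inter_subset_right⟩

lemma HereditarilyUnicoherent.continuumHull_subset_union (hX : HereditarilyUnicoherent X)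
    (x y z : X) : continuumHull x z ⊆ continuumHull x y ∪ continuumHull y z :=
  continuumHull_subset ((isClosed_continuumHull x y).union (isClosed_continuumHull y z))
    (IsPreconnected.union y (right_mem_continuumHull x y) (left_mem_continuumHull y z)
      (hX.isPreconnected_continuumHull x y) (hX.isPreconnected_continuumHull y z))
    (Or.inl (left_mem_continuumHull x y)) (Or.inr (right_mem_continuumHull y z))

/-- Adjoining a closed set with empty interior to a closed set does not enlarge its interior. -/
lemma HereditarilyUnicoherent.interior_continuumHull_subset (hX : HereditarilyUnicoherent X)
    (x : X) {y z : X} (hyz : interior (continuumHull y z) = ∅) :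
    interior (continuumHull x z) ⊆ interior (continuumHull x y) := by
  have h := interior_mono (hX.continuumHull_subset_union x y z)
  rwa [interior_union_isClosed_of_interior_empty (isClosed_continuumHull x y) hyz] at h

lemma HereditarilyUnicoherent.interior_continuumHull_congr (hX : HereditarilyUnicoherent X)
    (x : X) {y z : X} (hyz : interior (continuumHull y z) = ∅) :
    interior (continuumHull x y) = interior (continuumHull x z) :=
  (hX.interior_continuumHull_subset x (by rwa [continuumHull_comm])).antisymm
    (hX.interior_continuumHull_subset x hyz)

lemma HereditarilyUnicoherent.mem_meagerComposant_iff (hX : HereditarilyUnicoherent X)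
    {x y : X} : y ∈ meagerComposant x ↔ interior (continuumHull x y) = ∅ := by
  constructor
  · rintro ⟨L, ⟨hL, hLc, hLn, hx⟩, hy⟩
    rw [hL.isClosed.isNowhereDense_iff] at hLn
    exact subset_empty_iff.1 ((interior_mono
      (continuumHull_subset hL.isClosed hLc.isPreconnected hx hy)).trans hLn.subset)
  · intro h
    exact ⟨continuumHull x y, ⟨(isClosed_continuumHull x y).isCompact,
      ⟨⟨x, left_mem_continuumHull x y⟩, hX.isPreconnected_continuumHull x y⟩,
      (isClosed_continuumHull x y).isNowhereDense_iff.2 h, left_mem_continuumHull x y⟩,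
      right_mem_continuumHull x y⟩

/-- Nontriviality makes singletons nowhere dense, so each point belongs to its own meager composant.
-/
lemma HereditarilyUnicoherent.meagerComposant_eq_iff [Nontrivial X]
    (hX : HereditarilyUnicoherent X) {x y : X} :
    meagerComposant x = meagerComposant y ↔ interior (continuumHull x y) = ∅ := by
  constructor
  · intro h
    rw [← hX.mem_meagerComposant_iff, h, hX.mem_meagerComposant_iff,
      interior_continuumHull_self]
  · intro h
    ext z
    rw [hX.mem_meagerComposant_iff, hX.mem_meagerComposant_iff, continuumHull_comm x,
      continuumHull_comm y, hX.interior_continuumHull_congr z h]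

/-- Boundary bumping: in a connected compact Hausdorff space the component of `x` in the complement
of a nonempty open set `W` meets the closure of `W`. -/
lemma connectedComponentIn_compl_inter_closure_nonempty {W : Set X} (hW : IsOpen W)
    (hne : W.Nonempty) {x : X} (hx : x ∉ W) :
    (connectedComponentIn Wᶜ x ∩ closure W).Nonempty := by
  by_contra hcon
  have hcp : CompactSpace ↥Wᶜ := isCompact_iff_compactSpace.1 hW.isClosed_compl.isCompact
  let π : ↥Wᶜ → ConnectedComponents ↥Wᶜ := ConnectedComponents.mk
  have hπ : Continuous π := ConnectedComponents.continuous_coe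
  let B : Set (ConnectedComponents ↥Wᶜ) := π '' (Subtype.val ⁻¹' closure W)
  have hB : IsClosed B :=
    ((isClosed_closure.preimage continuous_subtype_val).isCompact.image hπ).isClosed
  have hxB : π ⟨x, hx⟩ ∈ Bᶜ := by
    rintro ⟨z, hz, hzx⟩
    refine hcon ⟨z, ?_, hz⟩
    rw [connectedComponentIn_eq_image (show x ∈ Wᶜ from hx)]
    exact mem_image_of_mem _ (ConnectedComponents.coe_eq_coe'.1 hzx)
  -- The component space is zero-dimensional, so a clopen set isolates the component of `x` from
  -- those meeting `closure W`.
  obtain ⟨Q, hQ, hxQ, hQB⟩ := compact_exists_isClopen_in_isOpen hB.isOpen_compl hxB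
  have hP := hQ.preimage hπ
  let P : Set X := Subtype.val '' (π ⁻¹' Q)
  have hPW : P ⊆ Wᶜ := by
    rintro _ ⟨z, -, rfl⟩
    exact z.2
  have hPcl : IsClosed P := hW.isClosed_compl.isClosedEmbedding_subtypeVal.isClosedMap _ hP.1
  -- Staying off `closure W` makes `P` open in `X`, not merely in `Wᶜ`.
  have hPo : IsOpen P := by
    obtain ⟨O, hO, hOP⟩ := isOpen_induced_iff.1 hP.2
    have : P = O ∩ (closure W)ᶜ := by
      ext z
      constructor
      · rintro ⟨z, hz, rfl⟩
        refine ⟨?_, fun hzW => hQB hz (mem_image_of_mem _ hzW)⟩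
        rw [← hOP] at hz
        exact hz
      · rintro ⟨hzO, hzW⟩
        have hzW' : z ∈ Wᶜ := fun h => hzW (subset_closure h)
        refine ⟨⟨z, hzW'⟩, ?_, rfl⟩
        rw [← hOP]
        exact hzO
    rw [this]
    exact hO.inter isClosed_closure.isOpen_compl
  have hPu : P = univ := IsClopen.eq_univ ⟨hPcl, hPo⟩ ⟨x, ⟨x, hx⟩, hxQ, rfl⟩
  obtain ⟨w, hw⟩ := hne
  exact hPW (hPu ▸ mem_univ w) hw

/-- This trades hulls for components of `Wᶜ`, which form a closed relation. -/
lemma HereditarilyUnicoherent.disjoint_continuumHull_iff (hX : HereditarilyUnicoherent X) {W : Set X} (hW : IsOpen W)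
    {x y : X} : Disjoint (continuumHull x y) W ↔ x ∉ W ∧ y ∈ connectedComponentIn Wᶜ x := by
  constructor
  · intro h
    have hsub : continuumHull x y ⊆ Wᶜ := fun z hz hzW => disjoint_left.1 h hz hzW
    exact ⟨hsub (left_mem_continuumHull x y),
      (hX.isPreconnected_continuumHull x y).subset_connectedComponentIn
        (left_mem_continuumHull x y) hsub (right_mem_continuumHull x y)⟩
  · rintro ⟨hx, hy⟩
    have := continuumHull_subset (isClosed_connectedComponentIn_compl hW x)
      isPreconnected_connectedComponentIn (mem_connectedComponentIn hx) hy
    rw [disjoint_left]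
    exact fun z hz => connectedComponentIn_subset _ _ (this hz)

end Hull

/-! ### Meager composants are meagre inside hulls -/

section Meagre

variable {X : Type*} [TopologicalSpace X]

lemma IsClosed.isNowhereDense_inter {C V : Set X} (hC : IsClosed C)
    (h : interior C ∩ V = ∅) : IsNowhereDense (C ∩ V) := by
  by_contra hne
  obtain ⟨z, hz⟩ := nonempty_iff_ne_empty.2 hne
  have hzV : z ∈ closure V := closure_mono inter_subset_right (interior_subset hz)
  obtain ⟨w, hw, hwV⟩ := mem_closure_iff.1 hzV _ isOpen_interior hz
  have hwC : w ∈ interior C := interior_mono (closure_minimal inter_subset_left hC) hw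
  exact (h ▸ ⟨hwC, hwV⟩ : w ∈ (∅ : Set X))

lemma IsClosed.isMeagre_frontier {C : Set X} (hC : IsClosed C) : IsMeagre (frontier C) :=
  (isClosed_frontier.isNowhereDense_iff.2 (interior_frontier hC)).isMeagre

variable [CompactSpace X] [T2Space X] [ConnectedSpace X]

/-- Otherwise take a small ball-like `O` around some `z ≠ x` in `interior C ∩ V`. By boundary
bumping the component `E` of `x` in `Oᶜ` meets `C`, so `E ∪ C` covers the hull of `x` and `p`. As
`C` misses `W`, some `q ∈ W` equivalent to `p` lies in `E`. Then `E` contains the hull of `x` and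
`q`, whose interior contains `z`; but `E` misses `z`. -/
lemma HereditarilyUnicoherent.interior_connectedComponentIn_inter_eq_empty [Nontrivial X]
    (hX : HereditarilyUnicoherent X) {x p : X} {V W : Set X} (hV : IsOpen V)
    (hVi : V ⊆ interior (continuumHull x p)) (hVM : V ⊆ closure (meagerComposant p))
    (hW : IsOpen W) (hWne : W.Nonempty) (hWV : W ⊆ V) :
    interior (connectedComponentIn Wᶜ p) ∩ V = ∅ := by
  by_contra hne
  obtain ⟨v, hv⟩ := nonempty_iff_ne_empty.2 hne
  set C := connectedComponentIn Wᶜ p with hCdef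
  have hpW : p ∈ Wᶜ := by
    by_contra hp
    rw [connectedComponentIn_eq_empty hp] at hCdef
    rw [hCdef, interior_empty] at hv
    exact hv.1
  obtain ⟨z, hz, hzx⟩ : ∃ z ∈ interior C ∩ V, z ≠ x := by
    by_contra! h
    have : v ∈ interior ({x} : Set X) :=
      interior_maximal (fun z hz => h z hz) (isOpen_interior.inter hV) hv
    rw [interior_singleton] at this
    exact this
  obtain ⟨O, hO, hzO, hOcl⟩ : ∃ O : Set X, IsOpen O ∧ z ∈ O ∧
      closure O ⊆ (interior C ∩ V) ∩ {x}ᶜ := by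
    obtain ⟨O, hO, hzO, hOcl, -⟩ := exists_open_between_and_isCompact_closure
      (isCompact_singleton (x := z)) ((isOpen_interior.inter hV).inter isOpen_compl_singleton)
      (singleton_subset_iff.2 ⟨hz, hzx⟩)
    exact ⟨O, hO, hzO rfl, hOcl⟩
  have hxO : x ∉ O := fun h => (hOcl (subset_closure h)).2 rfl
  obtain ⟨w, hwE, hwO⟩ := connectedComponentIn_compl_inter_closure_nonempty hO ⟨z, hzO⟩ hxO
  have hwC : w ∈ C := interior_subset (hOcl hwO).1.1
  have hEcl := isClosed_connectedComponentIn_compl hO x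
  have hxE : x ∈ connectedComponentIn Oᶜ x := mem_connectedComponentIn hxO
  have hcov : continuumHull x p ⊆ connectedComponentIn Oᶜ x ∪ C :=
    continuumHull_subset (hEcl.union (isClosed_connectedComponentIn_compl hW p))
      (IsPreconnected.union w hwE hwC isPreconnected_connectedComponentIn
        isPreconnected_connectedComponentIn) (Or.inl hxE) (Or.inr (mem_connectedComponentIn hpW))
  obtain ⟨a, ha⟩ := hWne
  obtain ⟨q, hqW, hqM⟩ := mem_closure_iff.1 (hVM (hWV ha)) W hW ha
  have hqE : q ∈ connectedComponentIn Oᶜ x :=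
    (hcov (interior_subset (hVi (hWV hqW)))).resolve_right fun h =>
      connectedComponentIn_subset _ _ h hqW
  have hzq : z ∈ continuumHull x q := by
    have := hVi hz.2
    rw [hX.interior_continuumHull_congr x (hX.mem_meagerComposant_iff.1 hqM)] at this
    exact interior_subset this
  exact connectedComponentIn_subset _ _
    (continuumHull_subset hEcl isPreconnected_connectedComponentIn hxE hqE hzq) hzO

variable [SecondCountableTopology X]

/-- Where `M` is somewhere dense, the hull of `p` and any `q ∈ M` misses some basic `W ⊆ V`, so
countably many nowhere dense components cover `M ∩ V`. The rest lies in the frontier of `closure M`.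
-/
lemma HereditarilyUnicoherent.isMeagre_meagerComposant_inter_interior_right [Nontrivial X]
    (hX : HereditarilyUnicoherent X) (x p : X) :
    IsMeagre (meagerComposant p ∩ interior (continuumHull x p)) := by
  set M := meagerComposant p
  set V := interior (continuumHull x p) ∩ interior (closure M) with hVdef
  have hVo : IsOpen V := isOpen_interior.inter isOpen_interior
  have hb := TopologicalSpace.isBasis_countableBasis X
  let 𝓑 : Set (Set X) := {W ∈ TopologicalSpace.countableBasis X | W ⊆ V}
  have h𝓑 : 𝓑.Countable := (TopologicalSpace.countable_countableBasis X).mono fun _ h => h.1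
  have hm : IsMeagre (⋃ W ∈ 𝓑, connectedComponentIn Wᶜ p ∩ V) := by
    refine isMeagre_biUnion h𝓑 fun W hW => IsNowhereDense.isMeagre ?_
    have hWo := hb.isOpen hW.1
    exact IsClosed.isNowhereDense_inter (isClosed_connectedComponentIn_compl hWo p)
      (hX.interior_connectedComponentIn_inter_eq_empty hVo inter_subset_left
        (inter_subset_right.trans interior_subset) hWo
        (TopologicalSpace.nonempty_of_mem_countableBasis hW.1) hW.2)
  refine (hm.union (isClosed_closure (s := M)).isMeagre_frontier).mono ?_
  rintro q ⟨hqM, hqi⟩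
  by_cases hqV : q ∈ V
  · left
    obtain ⟨a, haV, haI⟩ : ∃ a ∈ V, a ∉ continuumHull p q := by
      by_contra! h
      have : q ∈ interior (continuumHull p q) := interior_maximal h hVo hqV
      rw [hX.mem_meagerComposant_iff.1 hqM] at this
      exact this
    obtain ⟨W, hW, haW, hWsub⟩ := hb.exists_subset_of_mem_open
      (show a ∈ V ∩ (continuumHull p q)ᶜ from ⟨haV, haI⟩)
      (hVo.inter (isClosed_continuumHull p q).isOpen_compl)
    refine mem_biUnion (show W ∈ 𝓑 from ⟨hW, hWsub.trans inter_subset_left⟩) ⟨?_, hqV⟩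
    exact ((hX.disjoint_continuumHull_iff (hb.isOpen hW)).1
      (disjoint_left.2 fun z hz hzW => (hWsub hzW).2 hz)).2
  · right
    rw [isClosed_closure.frontier_eq]
    exact ⟨subset_closure hqM, fun h => hqV ⟨hqi, h⟩⟩

/-- The hulls from `x` and `y` to `p` cover that of `x` and `y`; only their frontiers escape the
preceding lemma. -/
theorem HereditarilyUnicoherent.isMeagre_meagerComposant_inter_interior [Nontrivial X]
    (hX : HereditarilyUnicoherent X) (x y p : X) :
    IsMeagre (meagerComposant p ∩ interior (continuumHull x y)) := by
  refine (((hX.isMeagre_meagerComposant_inter_interior_right x p).union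
    (hX.isMeagre_meagerComposant_inter_interior_right y p)).union
    ((isClosed_continuumHull x p).isMeagre_frontier.union
      (isClosed_continuumHull y p).isMeagre_frontier)).mono ?_
  rintro q ⟨hqM, hq⟩
  rw [(isClosed_continuumHull x p).frontier_eq, (isClosed_continuumHull y p).frontier_eq]
  have := hX.continuumHull_subset_union x p y (interior_subset hq)
  rw [continuumHull_comm p y] at this
  by_cases h1 : q ∈ interior (continuumHull x p)
  · exact Or.inl (Or.inl ⟨hqM, h1⟩)
  by_cases h2 : q ∈ interior (continuumHull y p)
  · exact Or.inl (Or.inr ⟨hqM, h2⟩)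
  exact Or.inr (this.imp (fun h => ⟨h, h1⟩) (fun h => ⟨h, h2⟩))

lemma HereditarilyUnicoherent.baireMeasurableSet_setOf_interior_eq_empty
    (hX : HereditarilyUnicoherent X) :
    BaireMeasurableSet {p : X × X | interior (continuumHull p.1 p.2) = ∅} := by
  have hb := TopologicalSpace.isBasis_countableBasis X
  let 𝓑 := TopologicalSpace.countableBasis X
  have h𝓑 : 𝓑.Countable := TopologicalSpace.countable_countableBasis X
  -- A closed hull has empty interior iff every basic `V` contains a basic `W` missing it.
  have hEq : {p : X × X | interior (continuumHull p.1 p.2) = ∅} = ⋂ V ∈ 𝓑,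
      ⋃ W ∈ {W ∈ 𝓑 | W ⊆ V}, {p : X × X | p.1 ∉ W ∧ p.2 ∈ connectedComponentIn Wᶜ p.1} := by
    ext ⟨a, b⟩
    simp only [mem_iInter, mem_iUnion, exists_prop]
    constructor
    · intro h V hV
      obtain ⟨z, hzV, hz⟩ : ∃ z ∈ V, z ∉ continuumHull a b := by
        by_contra! hcon
        obtain ⟨z, hz⟩ := TopologicalSpace.nonempty_of_mem_countableBasis hV
        have : z ∈ interior (continuumHull a b) := interior_maximal hcon (hb.isOpen hV) hz
        rw [show interior (continuumHull a b) = ∅ from h] at this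
        exact this
      obtain ⟨W, hW, -, hWsub⟩ := hb.exists_subset_of_mem_open
        (show z ∈ V ∩ (continuumHull a b)ᶜ from ⟨hzV, hz⟩)
        ((hb.isOpen hV).inter (isClosed_continuumHull a b).isOpen_compl)
      exact ⟨W, ⟨hW, hWsub.trans inter_subset_left⟩,
        (hX.disjoint_continuumHull_iff (hb.isOpen hW)).1
          (disjoint_left.2 fun w hw hwW => (hWsub hwW).2 hw)⟩
    · intro h
      by_contra hne
      obtain ⟨z, hz⟩ := nonempty_iff_ne_empty.2 hne
      obtain ⟨V, hV, -, hVsub⟩ := hb.exists_subset_of_mem_open hz isOpen_interior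
      obtain ⟨W, ⟨hW, hWV⟩, hd⟩ := h V hV
      obtain ⟨w, hw⟩ := TopologicalSpace.nonempty_of_mem_countableBasis hW
      exact disjoint_left.1 ((hX.disjoint_continuumHull_iff (hb.isOpen hW)).2 hd)
        (interior_subset (hVsub (hWV hw))) hw
  rw [hEq]
  refine BaireMeasurableSet.biInter h𝓑 fun V _ =>
    BaireMeasurableSet.biUnion (h𝓑.mono fun _ h => h.1) fun W hW => ?_
  exact (isClosed_setOf_mem_connectedComponentIn_compl
    (hb.isOpen hW.1)).isOpen_compl.baireMeasurableSet.of_compl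

/-- If some two points of a hereditarily unicoherent continuum lie in different meager composants,
then there is an injection of the Cantor set into the set of meager composants. -/
theorem HereditarilyUnicoherent.exists_injective_meagerComposant [Nontrivial X]
    (hX : HereditarilyUnicoherent X) {x y : X} (hxy : meagerComposant x ≠ meagerComposant y) :
    ∃ f : (ℕ → Bool) → X, Function.Injective fun a => meagerComposant (f a) := by
  set U : Set X := interior (continuumHull x y)
  have hU : IsOpen U := isOpen_interior
  have hUne : U.Nonempty := nonempty_iff_ne_empty.2 (mt hX.meagerComposant_eq_iff.2 hxy)
  have := hUne.to_subtype
  have := hU.locallyCompactSpace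
  let R : Set (U × U) := {p | interior (continuumHull (p.1 : X) p.2) = ∅}
  have hR : BaireMeasurableSet R :=
    hX.baireMeasurableSet_setOf_interior_eq_empty.preimage
      (f := Prod.map (Subtype.val : U → X) (Subtype.val : U → X)) (by fun_prop)
      (hU.isOpenMap_subtype_val.prodMap hU.isOpenMap_subtype_val)
  have hs : ∀ p : U, IsMeagre (Prod.mk p ⁻¹' R) := by
    intro p
    refine ((hX.isMeagre_meagerComposant_inter_interior x y p).preimage_of_isOpenMap
      continuous_subtype_val hU.isOpenMap_subtype_val).mono ?_
    intro q hq
    exact ⟨hX.mem_meagerComposant_iff.2 hq, q.2⟩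
  obtain ⟨f, hf⟩ := exists_forall_ne_mem_of_mem_residual
    (compl_mem_residual_of_forall_section hR hs)
  refine ⟨fun a => f a, fun a b hab => ?_⟩
  by_contra hne
  exact hf a b hne (hX.meagerComposant_eq_iff.1 hab)

end Meagre

/-! ### Counting meager composants -/

open Cardinal in
theorem HereditarilyUnicoherent.mk_meagerComposants {X : Type*} [MetricSpace X] [CompactSpace X]
    [ConnectedSpace X] (hX : HereditarilyUnicoherent X) :
    #(meagerComposants X) = 1 ∨ #(meagerComposants X) = 2 ^ ℵ₀ := by
  have hrange : meagerComposants X = range (meagerComposant : X → Set X) := by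
    ext M
    exact exists_congr fun x => eq_comm
  rw [hrange]
  -- A one-point `X` falls in the first case: its only meager composant is empty, since its
  -- singleton is open.
  by_cases hall : ∀ x y : X, meagerComposant x = meagerComposant y
  · left
    obtain ⟨x⟩ := (inferInstance : Nonempty X)
    rw [eq_one_iff_unique]
    refine ⟨⟨?_⟩, ⟨⟨_, x, rfl⟩⟩⟩
    rintro ⟨_, y, rfl⟩ ⟨_, z, rfl⟩
    exact Subtype.ext (hall y z)
  · right
    push Not at hall
    obtain ⟨x, y, hxy⟩ := hall
    have : Nontrivial X := ⟨x, y, fun h => hxy (h ▸ rfl)⟩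
    obtain ⟨f, hf⟩ := hX.exists_injective_meagerComposant hxy
    apply le_antisymm
    -- Upper bound: a compact metric space is an image of `ℕ → ℕ`; `ULift` only matches universes.
    · obtain ⟨g, -, hg⟩ := PolishSpace.exists_nat_nat_continuous_surjective X
      have h := mk_le_of_surjective (f := fun a : ULift (ℕ → ℕ) =>
        (⟨_, g a.down, rfl⟩ : range (meagerComposant : X → Set X))) (by
          rintro ⟨_, z, rfl⟩
          obtain ⟨a, rfl⟩ := hg z
          exact ⟨⟨a⟩, rfl⟩)
      exact h.trans_eq (by simp)
    · have h := mk_le_of_injective (f := fun a : ULift (ℕ → Bool) =>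
        (⟨_, f a.down, rfl⟩ : range (meagerComposant : X → Set X))) (by
          intro a b hab
          exact ULift.ext _ _ (hf (congrArg Subtype.val hab)))
      exact le_of_eq_of_le (by simp) h

theorem corollary15 {X : Type*} [MetricSpace X] [CompactSpace X] [ConnectedSpace X]
    (hX : IsTreeLike X) :
    Cardinal.mk (meagerComposants X) = 1 ∨
      Cardinal.mk (meagerComposants X) = 2 ^ Cardinal.aleph0 :=
  HereditarilyUnicoherent.mk_meagerComposants fun _ _ hA hB => hX.isPreconnected_inter hA hB
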